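/- Let $(W,S)$ be a finite Coxeter system. For $L\subseteq S$ let $W_L$ be the subgroup generated by $L$ (so $(W_L,L)$ is a Coxeter system and $W_S=W$), with length function $\ell_L$. For $I,J\subseteq L$ put $$X_I^L=\{w\in W_L : \ell_L(ws)>\ell_L(w)\ \text{for all } s\in I\},\qquad X_{IJ}^L=(X_I^L)^{-1}\cap X_J^L,\qquad x_I^L=\sum_{w\in X_I^L}w\in\mathbb{Q}W_L,$$ and let $\Sigma(W_L)\subseteq\mathbb{Q}W_L$ be the $\mathbb{Q}$-span of the $x_I^L$, $I\subseteq L$. These elements are linearly independent, and $\Sigma(W_L)$ is a unital subalgebra of $\mathbb{Q}W_L$ (Solomon's descent algebra). Let $\mathbb{Q}\,\mathrm{Irr}\,W_L$ be the $\mathbb{Q}$-span of the irreducible complex characters of $W_L$, and let $\theta_L:\Sigma(W_L)\to\mathbb{Q}\,\mathrm{Irr}\,W_L$ be the linear map with $\theta_L(x_I^L)=\mathrm{Ind}_{W_I}^{W_L}1$. For $K\subseteq L\subseteq S$ let $\mathrm{Res}_K^L:\Sigma(W_L)\to\Sigma(W_K)$ be the linear map with $$\mathrm{Res}_K^L(x_I^L)=\sum_{d\in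 X_{KI}^L}x^K_{K\cap dId^{-1}}\qquad(I\subseteq L).$$ Omit the superscript or subscript $L$ when $L=S$, and let $K\subseteq S$. Then: (a) $x_K\,\mathrm{Res}_K(x)=x\,x_K$ for all $x\in\Sigma(W)$. (b) $\mathrm{Res}_K$ is a homomorphism of (unital) $\mathbb{Q}$-algebras. (c) If $K\subseteq L\subseteq S$, then $\mathrm{Res}_K=\mathrm{Res}_K^L\circ\mathrm{Res}_L$. (d) $\mathrm{Res}^W_{W_K}\circ\theta=\theta_K\circ\mathrm{Res}_K$, where $\mathrm{Res}^W_{W_K}:\mathbb{Q}\,\mathrm{Irr}\,W\to\mathbb{Q}\,\mathrm{Irr}\,W_K$ is the restriction of characters. (e) If $K'\subseteq S$ and $d\in X_{KK'}$ satisfy $dK'd^{-1}=K$, then $z\mapsto dzd^{-1}$ is an isomorphism of algebras $d_*:\Sigma(W_{K'})\to\Sigma(W_K)$, and $\mathrm{Res}_K=d_*\circ\mathrm{Res}_{K'}$. (f) $\Sigma(W)=\ker\mathrm{Res}_K\oplus\Sigma(W)x_K$, and $\ker\mathrm{Res}_K=\{x\in\Sigma(W): x\,x_K=0\}$. -/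

import Mathlib

open scoped MonoidAlgebra

/-! ### Rational combinations of irreducible complex characters of a group -/

namespace CharacterSpace

/-- The set of irreducible complex characters of `G`, as functions `G → ℂ`. -/
noncomputable def irreducibleCharacters (G : Type*) [Group G] : Set (G → ℂ) :=
  {χ | ∃ (n : ℕ) (ρ : Representation ℂ G (Fin n → ℂ)),
    ρ.IsIrreducible ∧ χ = ρ.character}

/-- `ℚ Irr G`: the rational linear combinations of irreducible complex characters. -/
noncomputable def QIrr (G : Type*) [Group G] : Submodule ℚ (G → ℂ) :=
  Submodule.span ℚ (irreducibleCharacters G)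

theorem irreducible_char_mem {G V : Type*} [Group G] [AddCommGroup V] [Module ℂ V]
    [FiniteDimensional ℂ V] (ρ : Representation ℂ G V) (h : ρ.IsIrreducible) :
    ρ.character ∈ QIrr G := by
  let e : V ≃ₗ[ℂ] (Fin (Module.finrank ℂ V) → ℂ) := (Module.finBasis ℂ V).equivFun
  let σ : Representation ℂ G (Fin (Module.finrank ℂ V) → ℂ) :=
    { toFun := fun g => e.conj (ρ g)
      map_one' := by ext; simp [LinearEquiv.conj_apply]
      map_mul' := fun a b => by ext; simp [LinearEquiv.conj_apply] }
  let o : Subrepresentation ρ ≃o Subrepresentation σ :=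
    { toFun := fun p => ⟨p.toSubmodule.map (e : V →ₗ[ℂ] _), by
        rintro g _ ⟨v, hv, rfl⟩
        exact ⟨ρ g v, p.apply_mem_toSubmodule g hv, by simp [σ, LinearEquiv.conj_apply]⟩⟩
      invFun := fun p => ⟨p.toSubmodule.comap (e : V →ₗ[ℂ] _), by
        intro g v hv
        have := p.apply_mem_toSubmodule g hv
        simpa [σ, LinearEquiv.conj_apply] using this⟩
      left_inv := fun p => by
        apply Subrepresentation.toSubmodule_injective
        exact Submodule.comap_map_eq_of_injective e.injective _
      right_inv := fun p => by
        apply Subrepresentation.toSubmodule_injective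
        exact Submodule.map_comap_eq_of_surjective e.surjective _
      map_rel_iff' := fun {p q} => Submodule.map_le_map_iff_of_injective e.injective _ _ }
  refine Submodule.subset_span ⟨_, σ, o.isSimpleOrder_iff.mp h, ?_⟩
  funext g
  exact (LinearMap.trace_conj' (ρ g) e).symm

/-- By complete reducibility, the character of every finite-dimensional complex representation
of a finite group lies in `ℚ Irr G`. -/
theorem char_mem {G V : Type*} [Group G] [Finite G] [AddCommGroup V] [Module ℂ V]
    [FiniteDimensional ℂ V] (ρ : Representation ℂ G V) : ρ.character ∈ QIrr G := by
  suffices H : ∀ (n : ℕ) (V : Type _) [AddCommGroup V] [Module ℂ V] [FiniteDimensional ℂ V]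
      (ρ : Representation ℂ G V), Module.finrank ℂ V = n → ρ.character ∈ QIrr G from
    H _ V ρ rfl
  intro n
  induction n using Nat.strong_induction_on with
  | _ n ih =>
    intro V _ _ _ ρ hn
    rcases subsingleton_or_nontrivial V with hV | hV
    · have : ρ.character = 0 := by
        funext g
        have : ρ g = 0 := Subsingleton.elim _ _
        simp [Representation.character, this]
      rw [this]
      exact zero_mem _
    by_cases hs : ρ.IsIrreducible
    · exact irreducible_char_mem ρ hs
    have hnt : Nontrivial (Subrepresentation ρ) :=
      ⟨⊥, ⊤, fun h => bot_ne_top (α := Submodule ℂ V)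
        (congrArg Subrepresentation.toSubmodule h)⟩
    obtain ⟨p, hp⟩ : ∃ p : Subrepresentation ρ, p ≠ ⊥ ∧ p ≠ ⊤ := by
      by_contra hcon
      push Not at hcon
      exact hs ⟨fun p => or_iff_not_imp_left.mpr (hcon p)⟩
    have : NeZero (Nat.card G : ℂ) := ⟨by exact_mod_cast Nat.card_pos.ne'⟩
    obtain ⟨q, hq⟩ := exists_isCompl p
    have hc : IsCompl p.toSubmodule q.toSubmodule := by
      refine ⟨disjoint_iff.mpr ?_, codisjoint_iff.mpr ?_⟩
      · exact congrArg Subrepresentation.toSubmodule (disjoint_iff.mp hq.1)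
      · exact congrArg Subrepresentation.toSubmodule (codisjoint_iff.mp hq.2)
    have hp1 : p.toSubmodule ≠ ⊤ := fun h => hp.2 (Subrepresentation.toSubmodule_injective h)
    have hp0 : p.toSubmodule ≠ ⊥ := fun h => hp.1 (Subrepresentation.toSubmodule_injective h)
    have hq1 : q.toSubmodule ≠ ⊤ := fun h => by
      have h1 := disjoint_iff.mp hc.1
      rw [h, inf_top_eq] at h1
      exact hp0 h1
    have key : ρ.character = p.toRepresentation.character + q.toRepresentation.character := by
      funext g
      let e := Submodule.prodEquivOfIsCompl _ _ hc
      have h1 : ρ g = e.conj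
          (LinearMap.prodMap (p.toRepresentation g) (q.toRepresentation g)) := by
        apply LinearMap.ext
        intro v
        obtain ⟨⟨a, b⟩, rfl⟩ := e.surjective v
        simp [e, LinearEquiv.conj_apply, Subrepresentation.toRepresentation]
      simp only [Representation.character, Pi.add_apply]
      rw [h1, LinearMap.trace_conj', LinearMap.trace_prodMap']
    rw [key]
    exact add_mem
      (ih _ (hn ▸ Submodule.finrank_lt hp1) _ _ rfl)
      (ih _ (hn ▸ Submodule.finrank_lt hq1) _ _ rfl)

/-- Restriction `ℚ Irr G → ℚ Irr H` of characters along a group homomorphism `f : H → G`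
(below: the inclusion of a subgroup), that is `χ ↦ χ ∘ f`. -/
noncomputable def restrict {G H : Type*} [Group G] [Group H] [Finite H] (f : H →* G) :
    QIrr G →ₗ[ℚ] QIrr H :=
  (LinearMap.funLeft ℚ ℂ f).restrict (by
    suffices h : QIrr G ≤ (QIrr H).comap (LinearMap.funLeft ℚ ℂ f) from fun χ hχ => h hχ
    refine Submodule.span_le.mpr ?_
    rintro _ ⟨n, ρ, -, rfl⟩
    exact char_mem (ρ.comp f))

end CharacterSpace

/-! ### Descent algebras

Everything is done inside one finite group `W`.  A subset `L` of `W` plays the role of the set of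
simple reflections of the group `W_L` generated by `L`; the constructions below are those of the
pair `(W_L, L)`, seen inside `W` and inside the group algebra `ℚ[W]`.  For `L = S` they are the
constructions of `(W, S)` itself. -/

namespace DescentAlgebra

variable {W : Type*} [Group W]

/-- The subgroup `W_I` generated by `I`. -/
abbrev parabolic (I : Set W) : Subgroup W := Subgroup.closure I

/-- The length, with respect to the generators `L`, of an element of `W_L`: the least length of
a word in `L` representing it.  (The elements of `L` will be involutions.) -/
noncomputable def length (L : Set W) (w : W) : ℕ :=
  sInf {n | ∃ l : List W, l.length = n ∧ (∀ s ∈ l, s ∈ L) ∧ l.prod = w}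

/-- `X_I^L = {w ∈ W_L | ∀ s ∈ I, ws > w}` -/
def X (L I : Set W) : Set W :=
  {w | w ∈ parabolic L ∧ ∀ s ∈ I, length L w < length L (w * s)}

/-- `X_{IJ}^L = (X_I^L)⁻¹ ∩ X_J^L` -/
def X₂ (L I J : Set W) : Set W := {d | d⁻¹ ∈ X L I ∧ d ∈ X L J}

/-- `ᵈI = d I d⁻¹` -/
def conj (d : W) (I : Set W) : Set W := (fun s => d * s * d⁻¹) '' I

variable [Finite W]

/-- `x_I^L`, the sum of the elements of `X_I^L` in the group algebra -/
noncomputable def x (L I : Set W) : ℚ[W] :=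
  ∑ w ∈ (X L I).toFinite.toFinset, MonoidAlgebra.of ℚ W w

/-- `Σ(W_L)`, the span of the elements `x_I^L` with `I ⊆ L` -/
noncomputable def descent (L : Set W) : Submodule ℚ ℚ[W] :=
  Submodule.span ℚ (Set.range fun I : {I : Set W // I ⊆ L} => x L I)

theorem x_mem {L I : Set W} (h : I ⊆ L) : x L I ∈ descent L :=
  Submodule.subset_span ⟨⟨I, h⟩, rfl⟩

open Classical in
/-- The linear map `Σ(W_L) → V` that sends `x_I^L` to `v I` for all `I ⊆ L`.  As the `x_I^L` form
a basis of `Σ(W_L)`, there is exactly one; the value `0` is never used for parabolic subgroups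
of finite Coxeter groups. -/
noncomputable def linearExtension (L : Set W) {V : Type*} [AddCommGroup V] [Module ℚ V]
    (v : {I : Set W // I ⊆ L} → V) : descent L →ₗ[ℚ] V :=
  if h : ∃ f : descent L →ₗ[ℚ] V, ∀ I : {I : Set W // I ⊆ L}, f ⟨x L I, x_mem I.2⟩ = v I
  then h.choose else 0

/-- `Res_K^L : Σ(W_L) → Σ(W_K)`, `x_I^L ↦ ∑_{d ∈ X_{KI}^L} x_{K ∩ ᵈI}^K` -/
noncomputable def res (L K : Set W) : descent L →ₗ[ℚ] descent K :=
  linearExtension L fun I =>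
    ∑ d ∈ (X₂ L K I).toFinite.toFinset, ⟨x K (K ∩ conj d I), x_mem Set.inter_subset_left⟩

/-- The character of `W_L` induced from the trivial character of `W_I`, for `I ⊆ L` -/
noncomputable def inducedTrivial (L : Set W) (I : {I : Set W // I ⊆ L}) :
    CharacterSpace.QIrr (parabolic L) :=
  ⟨(Representation.ind (Subgroup.inclusion (Subgroup.closure_mono I.2))
      (Representation.trivial ℂ (parabolic I.1) ℂ)).character, CharacterSpace.char_mem _⟩

/-- `θ_L : Σ(W_L) → ℚ Irr W_L`, `x_I^L ↦ Ind_{W_I}^{W_L} 1` -/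
noncomputable def θ (L : Set W) : descent L →ₗ[ℚ] CharacterSpace.QIrr (parabolic L) :=
  linearExtension L (inducedTrivial L)

end DescentAlgebra

/-! Two product formulas carry the theorem: `x_mul_x_of_subset`, that is $x_K x_I^K = x_I$ for
$I\subseteq K$, and Solomon's formula `x_mul_x`, $x_I x_K=\sum_{d\in X_{KI}}x_{K\cap dId^{-1}}$.
Together they give $x_K\,\mathrm{Res}_K(x)=x\,x_K$. Since $X_K$ meets $W_K$ only in $1$ and
represents the cosets of $W_K$, left multiplication by $x_K$ is injective on $\Sigma(W_K)$
(`x_mul_injOn`). So $\mathrm{Res}_K(x)$ is the unique $z\in\Sigma(W_K)$ with $x_K z=x\,x_K$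
(`res_eq`); multiplicativity, transitivity, conjugation and the kernel all follow by checking this
one equation.

For the direct sum, $\mathrm{Res}_K(x_K)$ is right invertible in $\Sigma(W_K)$
(`exists_right_inverse`), so $y x_K x_K=0$ forces $y x_K=0$. The kernel and image of right
multiplication by $x_K$ therefore meet in $0$, and rank-nullity finishes.

For characters, $\mathrm{Ind}_{W_I}^{W}1$ at $g$ counts the $w\in X_I$ with $w^{-1}gw\in W_I$, and
the decomposition of $X_I$ into the sets $X^K_{K\cap dId^{-1}}d$ splits this count (Mackey).

All coset combinatorics rests on right inversions and their rule under products
(`isRightInversion_mul_iff`), obtained from a $\mathbb{Z}/2$-valued cocycle. -/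

/-! ### The reflection cocycle and the exchange condition -/

namespace CoxeterSystem

variable {B W : Type*} [Group W] {M : CoxeterMatrix B} (cs : CoxeterSystem M W)

open Classical in
/-- The involution `(t, ε) ↦ (s t s, ε + [t = s])` of `W × ℤ/2` attached to a simple
reflection `s`. -/
noncomputable def signedConj (i : B) : Equiv.Perm (W × ZMod 2) :=
  Function.Involutive.toPerm
    (fun p => (cs.simple i * p.1 * cs.simple i, p.2 + if p.1 = cs.simple i then 1 else 0)) (by
      rintro ⟨t, e⟩
      have h : cs.simple i * t * cs.simple i = cs.simple i ↔ t = cs.simple i := by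
        constructor
        · intro h
          have := congrArg (fun z => cs.simple i * z * cs.simple i) h
          simpa [mul_assoc] using this
        · rintro rfl; simp
      ext
      · simp [mul_assoc]
      · by_cases ht : t = cs.simple i
        · simp [ht, add_assoc, CharTwo.add_self_eq_zero]
        · simp [h, ht])

open Classical in
theorem signedConj_apply (i : B) (t : W) (e : ZMod 2) : cs.signedConj i (t, e) =
    (cs.simple i * t * cs.simple i, e + if t = cs.simple i then 1 else 0) := rfl

-- With $p=s_is_j$, conjugation by $s_j$ inverts $p$. Hence the $(n+1)$st factor flips the sign
-- exactly at $t=s_jp^{2n}$ and $t=s_jp^{2n+1}$.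
open Classical in
theorem signedConj_mul_pow_apply (i j : B) (n : ℕ) (t : W) (e : ZMod 2) :
    ((cs.signedConj i * cs.signedConj j) ^ n) (t, e) =
      ((cs.simple i * cs.simple j) ^ n * t * ((cs.simple i * cs.simple j) ^ n)⁻¹,
        e + ∑ r ∈ Finset.range (2 * n),
          if t = cs.simple j * (cs.simple i * cs.simple j) ^ r then 1 else 0) := by
  induction n with
  | zero => simp
  | succ n ih =>
    set p := cs.simple i * cs.simple j with hp
    have hpj : ∀ k : ℕ, (p ^ k)⁻¹ * cs.simple j = cs.simple j * p ^ k := by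
      intro k
      have h1 : cs.simple j * p * (cs.simple j)⁻¹ = p⁻¹ := by simp [hp, mul_assoc]
      have h2 := conj_pow (i := k) (a := cs.simple j) (b := p)
      rw [h1, inv_pow] at h2
      rw [h2, inv_mul_cancel_right]
    have e1 : p ^ n * t * (p ^ n)⁻¹ = cs.simple j ↔ t = cs.simple j * p ^ (2 * n) := by
      rw [mul_inv_eq_iff_eq_mul, ← eq_inv_mul_iff_mul_eq, ← mul_assoc, hpj, mul_assoc, ← pow_add,
        two_mul]
    have e2 : cs.simple j * (p ^ n * t * (p ^ n)⁻¹) * cs.simple j = cs.simple i ↔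
        t = cs.simple j * p ^ (2 * n + 1) := by
      have : cs.simple j * (p ^ n * t * (p ^ n)⁻¹) * cs.simple j = cs.simple i ↔
          p ^ n * t * (p ^ n)⁻¹ = cs.simple j * p := by
        constructor
        · intro h
          have h' := congrArg (fun z => cs.simple j * z) h
          simp only [← mul_assoc, simple_mul_simple_self, one_mul] at h'
          rw [hp, ← mul_assoc, ← h']; simp [mul_assoc, hp]
        · intro h
          rw [h, hp]; simp [mul_assoc]
      rw [this, mul_inv_eq_iff_eq_mul, ← eq_inv_mul_iff_mul_eq, mul_assoc, ← mul_assoc, hpj,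
        mul_assoc, ← pow_succ', ← pow_add]
      congr! 3
      ring
    rw [pow_succ', Equiv.Perm.mul_apply, ih, Equiv.Perm.mul_apply, signedConj_apply,
      signedConj_apply, mul_add, mul_one, Finset.sum_range_succ, Finset.sum_range_succ]
    ext
    · simp [hp, pow_succ', mul_assoc]
    · simp only [e1, e2, add_assoc]

/-- For $n=m_{ij}$ one has $p^n=1$, so the $2n$ sign terms form two equal halves and cancel mod 2.
-/
theorem signedConj_isLiftable : M.IsLiftable cs.signedConj := by
  classical
  intro i j
  ext1 ⟨t, e⟩
  rw [signedConj_mul_pow_apply, cs.simple_mul_simple_pow, two_mul, Finset.sum_range_add]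
  simp [pow_add, CharTwo.add_self_eq_zero]

/-- The action of `W` on `W × ℤ/2` extending `signedConj`. -/
noncomputable def signedConjHom : W →* Equiv.Perm (W × ZMod 2) :=
  cs.lift ⟨cs.signedConj, cs.signedConj_isLiftable⟩

/-- The reflection cocycle: the parity of the number of occurrences of `t` in the inversion
sequence of a word for `w`. -/
noncomputable def cocycle (w t : W) : ZMod 2 := (cs.signedConjHom w (t, 0)).2

theorem signedConjHom_simple (i : B) : cs.signedConjHom (cs.simple i) = cs.signedConj i :=
  cs.lift_apply_simple _ _

theorem signedConjHom_apply (w t : W) (e : ZMod 2) :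
    cs.signedConjHom w (t, e) = (w * t * w⁻¹, e + cs.cocycle w t) := by
  suffices h : ∀ (t : W) (e : ZMod 2), (cs.signedConjHom w (t, e)).1 = w * t * w⁻¹ ∧
      (cs.signedConjHom w (t, e)).2 = e + cs.cocycle w t from Prod.ext (h t e).1 (h t e).2
  unfold cocycle
  induction w using cs.simple_induction_left with
  | one => simp
  | mul_simple_left w i ih =>
    intro t e
    simp only [map_mul, Equiv.Perm.mul_apply, signedConjHom_simple]
    obtain ⟨h1, h2⟩ := ih t e
    obtain ⟨h3, h4⟩ := ih t 0
    rw [← Prod.mk.eta (p := cs.signedConjHom w (t, e)),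
      ← Prod.mk.eta (p := cs.signedConjHom w (t, 0)), signedConj_apply, signedConj_apply,
      h1, h2, h3]
    constructor
    · simp [mul_assoc]
    · simp [add_assoc]

theorem cocycle_mul (x y t : W) :
    cs.cocycle (x * y) t = cs.cocycle y t + cs.cocycle x (y * t * y⁻¹) := by
  conv_lhs => rw [cocycle, map_mul, Equiv.Perm.mul_apply, signedConjHom_apply,
    signedConjHom_apply, zero_add]

open Classical in
theorem cocycle_simple (i : B) (t : W) :
    cs.cocycle (cs.simple i) t = if t = cs.simple i then 1 else 0 := by
  rw [cocycle, signedConjHom_simple, signedConj_apply, zero_add]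

theorem cocycle_one (t : W) : cs.cocycle 1 t = 0 := by simp [cocycle]

/-- For $t=vsv^{-1}$ the contributions of $v$ and $v^{-1}$ cancel, because $vv^{-1}=1$ has zero
cocycle; only the contribution of $s$ at $s$ remains. -/
theorem cocycle_self {t : W} (ht : cs.IsReflection t) : cs.cocycle t t = 1 := by
  obtain ⟨v, i, rfl⟩ := ht
  have h := cs.cocycle_mul v v⁻¹ (v * cs.simple i * v⁻¹)
  rw [mul_inv_cancel, cocycle_one] at h
  rw [cocycle_mul, cocycle_mul]
  simp only [mul_assoc, inv_mul_cancel_left, inv_inv, inv_mul_cancel, mul_one, one_mul, inv_simple,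
    simple_mul_simple_self, cocycle_simple, if_true] at h ⊢
  rw [add_left_comm, ← h, add_zero]

theorem mem_rightInvSeq_of_cocycle_ne_zero {ω : List B} {t : W}
    (h : cs.cocycle (cs.wordProd ω) t ≠ 0) : t ∈ cs.rightInvSeq ω := by
  induction ω with
  | nil => simp [cocycle_one] at h
  | cons i ω ih =>
    rw [wordProd_cons, cocycle_mul, cocycle_simple] at h
    rw [rightInvSeq, List.mem_cons]
    by_cases h' : cs.wordProd ω * t * (cs.wordProd ω)⁻¹ = cs.simple i
    · left; rw [← h']; group
    · right; exact ih (by simpa [h'] using h)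

theorem isRightInversion_iff_cocycle {w t : W} (ht : cs.IsReflection t) :
    cs.IsRightInversion w t ↔ cs.cocycle w t = 1 := by
  have key : ∀ v, cs.cocycle v t = 1 → cs.IsRightInversion v t := by
    intro v hv
    obtain ⟨ω, hω, rfl⟩ := cs.exists_isReduced v
    exact cs.isRightInversion_of_mem_rightInvSeq hω
      (cs.mem_rightInvSeq_of_cocycle_ne_zero (by rw [hv]; exact one_ne_zero))
  refine ⟨fun h => ?_, key w⟩
  by_contra hn
  have h0 : cs.cocycle w t = 0 := by
    revert hn
    generalize cs.cocycle w t = a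
    revert a
    decide
  -- If the cocycle of $w$ vanished at $t$, that of $wt$ would be $1$, making $t$ an inversion of
  -- both $w$ and $wt$.
  refine ht.not_isRightInversion_mul_left_iff.mpr h (key _ ?_)
  rw [cocycle_mul, cs.cocycle_self ht, mul_inv_cancel_right, h0, add_zero]

/-- `N(xy) = N(y) Δ y⁻¹N(x)y`, where `N(w)` is the set of right inversions of `w`. -/
theorem isRightInversion_mul_iff {x y t : W} (ht : cs.IsReflection t) :
    cs.IsRightInversion (x * y) t ↔
      ¬(cs.IsRightInversion y t ↔ cs.IsRightInversion x (y * t * y⁻¹)) := by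
  rw [cs.isRightInversion_iff_cocycle ht, cs.isRightInversion_iff_cocycle ht,
    cs.isRightInversion_iff_cocycle (ht.conj y), cocycle_mul]
  generalize cs.cocycle y t = a
  generalize cs.cocycle x (y * t * y⁻¹) = b
  revert a b
  decide

/-- The exchange condition. -/
theorem mem_rightInvSeq_of_isRightInversion {ω : List B} {t : W}
    (h : cs.IsRightInversion (cs.wordProd ω) t) : t ∈ cs.rightInvSeq ω :=
  cs.mem_rightInvSeq_of_cocycle_ne_zero (by
    rw [(cs.isRightInversion_iff_cocycle h.1).mp h]; exact one_ne_zero)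

theorem not_isRightInversion_one (t : W) : ¬cs.IsRightInversion 1 t := by
  simp [IsRightInversion]

theorem isRightInversion_simple_iff {i : B} {t : W} :
    cs.IsRightInversion (cs.simple i) t ↔ t = cs.simple i := by
  constructor
  · intro h
    rw [cs.isRightInversion_iff_cocycle h.1, cocycle_simple] at h
    by_contra hn
    simp [hn] at h
  · rintro rfl
    simp [IsRightInversion, isReflection_simple]

end CoxeterSystem

/-! ### Minimal coset representatives of parabolic subgroups -/

namespace DescentAlgebra

variable {B W : Type*} [Group W] {M : CoxeterMatrix B} (cs : CoxeterSystem M W)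
  {L K I J : Set W}

open CoxeterSystem

theorem isReflection_of_mem (hL : L ⊆ Set.range cs.simple) {s : W} (hs : s ∈ L) :
    cs.IsReflection s := by
  obtain ⟨i, rfl⟩ := hL hs
  exact cs.isReflection_simple i

theorem parabolic_induction (hL : L ⊆ Set.range cs.simple)
    {p : ∀ w, w ∈ parabolic L → Prop} (one : p 1 (one_mem _))
    (mul : ∀ (w) (hw : w ∈ parabolic L) (s) (hs : s ∈ L), p w hw →
      p (w * s) (mul_mem hw (Subgroup.subset_closure hs))) {w : W} (hw : w ∈ parabolic L) :
    p w hw := by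
  induction hw using Subgroup.closure_induction_right with
  | one => exact one
  | mul_right w hw s hs ih => exact mul w hw s hs ih
  | mul_inv_cancel w hw s hs ih =>
    simp_rw [(isReflection_of_mem cs hL hs).inv]
    exact mul w hw s hs ih

/-- Multiplying on the right by $s\in L$ creates no inversions beyond $s$ and the $s$-conjugates of
old ones. -/
theorem mem_parabolic_of_isRightInversion (hL : L ⊆ Set.range cs.simple) {w t : W}
    (hw : w ∈ parabolic L) (h : cs.IsRightInversion w t) : t ∈ parabolic L := by
  induction hw using parabolic_induction cs hL generalizing t with
  | one => exact absurd h (cs.not_isRightInversion_one t)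
  | mul w hw s hs ih =>
    have hsL : s ∈ parabolic L := Subgroup.subset_closure hs
    by_cases h1 : cs.IsRightInversion s t
    · obtain ⟨i, rfl⟩ := hL hs
      rw [cs.isRightInversion_simple_iff.mp h1]
      exact hsL
    · have h2 : cs.IsRightInversion w (s * t * s⁻¹) := by
        have := (cs.isRightInversion_mul_iff h.1).mp h
        tauto
      have := ih h2
      rwa [Subgroup.mul_mem_cancel_right _ (inv_mem hsL), Subgroup.mul_mem_cancel_left _ hsL]
        at this

/-- When appending a letter shortens the element, the exchange condition deletes a letter of the old
word instead, so the word stays in $L$. -/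
theorem exists_word (hL : L ⊆ Set.range cs.simple) {w : W} (hw : w ∈ parabolic L) :
    ∃ ω : List B, (∀ i ∈ ω, cs.simple i ∈ L) ∧ ω.length = cs.length w ∧ cs.wordProd ω = w := by
  induction hw using parabolic_induction cs hL with
  | one => exact ⟨[], by simp⟩
  | mul w hw s hs ih =>
    obtain ⟨ω, h1, h2, rfl⟩ := ih
    obtain ⟨i, rfl⟩ := hL hs
    rcases cs.length_mul_simple (cs.wordProd ω) i with h | h
    · refine ⟨ω.concat i, ?_, by simp [h, h2], cs.wordProd_concat i ω⟩
      intro j hj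
      rw [List.concat_eq_append, List.mem_append, List.mem_singleton] at hj
      rcases hj with hj | rfl
      exacts [h1 j hj, hs]
    · have hinv : cs.IsRightInversion (cs.wordProd ω) (cs.simple i) :=
        ⟨cs.isReflection_simple i, by omega⟩
      obtain ⟨k, hk, hki⟩ := List.getElem_of_mem (cs.mem_rightInvSeq_of_isRightInversion hinv)
      have hk' : k < ω.length := by simpa using hk
      refine ⟨ω.eraseIdx k, fun j hj => h1 j (List.mem_of_mem_eraseIdx hj), ?_, ?_⟩
      · rw [List.length_eraseIdx_of_lt hk']; omega
      · rw [← cs.wordProd_mul_getD_rightInvSeq, List.getD_eq_getElem _ _ hk, hki]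

/-- This lets inversions in $W$ serve for every parabolic subgroup at once. -/
theorem length_eq (hL : L ⊆ Set.range cs.simple) {w : W} (hw : w ∈ parabolic L) :
    length L w = cs.length w := by
  obtain ⟨ω, h1, h2, h3⟩ := exists_word cs hL hw
  have hmem : cs.length w ∈ {n | ∃ l : List W, l.length = n ∧ (∀ s ∈ l, s ∈ L) ∧ l.prod = w} :=
    ⟨ω.map cs.simple, by simpa using h2, by simpa using h1, h3⟩
  refine le_antisymm (Nat.sInf_le hmem) (le_csInf ⟨_, hmem⟩ ?_)
  rintro _ ⟨l, rfl, hl, rfl⟩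
  clear * - hl hL
  induction l with
  | nil => simp
  | cons s l ih =>
    obtain ⟨i, rfl⟩ := hL (hl s (by simp))
    have := ih fun t ht => hl t (by simp [ht])
    have h := cs.length_mul_le (cs.simple i) l.prod
    rw [cs.length_simple] at h
    simp only [List.prod_cons, List.length_cons]
    omega

theorem mem_of_mem_parabolic (hL : L ⊆ Set.range cs.simple) {w : W} (hw : w ∈ parabolic L)
    (h : cs.length w = 1) : w ∈ L := by
  obtain ⟨ω, h1, h2, rfl⟩ := exists_word cs hL hw
  rw [h, List.length_eq_one_iff] at h2
  obtain ⟨i, rfl⟩ := h2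
  simpa using h1 i

theorem exists_isRightInversion (hL : L ⊆ Set.range cs.simple) {w : W} (hw : w ∈ parabolic L)
    (h : w ≠ 1) : ∃ s ∈ L, cs.IsRightInversion w s := by
  obtain ⟨ω, h1, h2, rfl⟩ := exists_word cs hL hw
  rcases List.eq_nil_or_concat ω with rfl | ⟨ω, i, rfl⟩
  · simp at h
  · refine ⟨cs.simple i, h1 i (by simp), cs.isReflection_simple i, ?_⟩
    rw [← h2, wordProd_concat, mul_assoc, simple_mul_simple_self, mul_one]
    have := cs.length_wordProd_le ω
    simp
    omega

theorem mem_X_iff (hL : L ⊆ Set.range cs.simple) (hI : I ⊆ L) {w : W} :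
    w ∈ X L I ↔ w ∈ parabolic L ∧ ∀ s ∈ I, ¬cs.IsRightInversion w s := by
  refine and_congr_right fun hw => forall₂_congr fun s hs => ?_
  have hr := isReflection_of_mem cs (hI.trans hL) hs
  have := hr.length_mul_left_ne w
  rw [length_eq cs hL hw, length_eq cs hL (mul_mem hw (Subgroup.subset_closure (hI hs)))]
  simp only [IsRightInversion, hr, true_and]
  omega

theorem parabolic_mono (hI : I ⊆ L) : parabolic I ≤ parabolic L := Subgroup.closure_mono hI

/-- Every coset `w W_I` contains an element none of whose inversions lies in `W_I`. -/
theorem exists_minimal_mul (I : Set W) (w : W) : ∃ x, ∃ u ∈ parabolic I, w = x * u ∧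
    ∀ t ∈ parabolic I, ¬cs.IsRightInversion x t := by
  -- Take an element of minimal length in the coset: an inversion in $W_I$ would give a shorter one.
  obtain ⟨u, hu⟩ : ∃ u : parabolic I, ∀ v : parabolic I,
      cs.length (w * u) ≤ cs.length (w * v) :=
    ⟨_, fun v => Function.argmin_le (fun u : parabolic I => cs.length (w * u)) v⟩
  refine ⟨w * u, (u : W)⁻¹, inv_mem u.2, by simp, fun t ht h => ?_⟩
  have := hu (u * ⟨t, ht⟩)
  have h2 := h.2
  rw [mul_assoc] at h2
  exact absurd this (not_le.mpr h2)

/-- Passes from simple reflections to all of $W_I$. Write $w=xu$ with $x$ minimal in $wW_I$; if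
$u\ne1$, a simple inversion of $u$ is one of $w$ too, since $x$ has no inversions in $W_I$. -/
theorem not_isRightInversion_of_mem_X (hL : L ⊆ Set.range cs.simple) (hI : I ⊆ L) {w t : W}
    (hw : w ∈ X L I) (ht : t ∈ parabolic I) : ¬cs.IsRightInversion w t := by
  obtain ⟨x, u, hu, rfl, hx⟩ := exists_minimal_mul cs I w
  suffices u = 1 by
    rw [this, mul_one]
    exact hx t ht
  by_contra hn
  obtain ⟨s, hs, h⟩ := exists_isRightInversion cs (hI.trans hL) hu hn
  refine ((mem_X_iff cs hL hI).mp hw).2 s hs ?_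
  rw [cs.isRightInversion_mul_iff h.1]
  have := hx (u * s * u⁻¹) (mul_mem (mul_mem hu (Subgroup.subset_closure hs)) (inv_mem hu))
  tauto

theorem isRightInversion_mul_iff_of_mem_X (hL : L ⊆ Set.range cs.simple) (hI : I ⊆ L)
    {x u t : W} (hx : x ∈ X L I) (hu : u ∈ parabolic I) (ht : t ∈ parabolic I) :
    cs.IsRightInversion (x * u) t ↔ cs.IsRightInversion u t := by
  by_cases hr : cs.IsReflection t
  · rw [cs.isRightInversion_mul_iff hr]
    have := not_isRightInversion_of_mem_X cs hL hI hx
      (mul_mem (mul_mem hu ht) (inv_mem hu))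
    tauto
  · exact ⟨fun h => absurd h.1 hr, fun h => absurd h.1 hr⟩

theorem length_mul_of_mem_X (hL : L ⊆ Set.range cs.simple) (hI : I ⊆ L)
    {x u : W} (hx : x ∈ X L I) (hu : u ∈ parabolic I) :
    cs.length (x * u) = cs.length x + cs.length u := by
  induction hu using parabolic_induction cs (hI.trans hL) with
  | one => simp
  | mul u hu s hs ih =>
    have h := isRightInversion_mul_iff_of_mem_X cs hL hI hx hu (Subgroup.subset_closure hs)
    obtain ⟨i, rfl⟩ := hL (hI hs)
    simp only [IsRightInversion, cs.isReflection_simple, true_and] at h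
    have h1 := cs.length_mul_simple (x * u) i
    have h2 := cs.length_mul_simple u i
    rw [mul_assoc] at h h1
    omega

theorem exists_mem_X_mul (hL : L ⊆ Set.range cs.simple) (hI : I ⊆ L) {w : W}
    (hw : w ∈ parabolic L) : ∃ x ∈ X L I, ∃ u ∈ parabolic I, w = x * u := by
  obtain ⟨x, u, hu, rfl, hx⟩ := exists_minimal_mul cs I w
  have hxL : x ∈ parabolic L := by
    rwa [Subgroup.mul_mem_cancel_right _ (parabolic_mono hI hu)] at hw
  exact ⟨x, (mem_X_iff cs hL hI).mpr ⟨hxL, fun s hs => hx s (Subgroup.subset_closure hs)⟩,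
    u, hu, rfl⟩

theorem eq_of_mem_X (hL : L ⊆ Set.range cs.simple) (hI : I ⊆ L) {x y : W}
    (hx : x ∈ X L I) (hy : y ∈ X L I) (h : x⁻¹ * y ∈ parabolic I) : x = y := by
  suffices h1 : x⁻¹ * y = 1 from (inv_mul_eq_one.mp h1)
  by_contra hn
  obtain ⟨s, hs, hi⟩ := exists_isRightInversion cs (hI.trans hL) h hn
  have h2 := isRightInversion_mul_iff_of_mem_X cs hL hI hx h (Subgroup.subset_closure hs)
  rw [mul_inv_cancel_left] at h2
  exact ((mem_X_iff cs hL hI).mp hy).2 s hs (h2.mpr hi)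

theorem X_anti (h : I ⊆ J) : X L J ⊆ X L I := fun _ hw => ⟨hw.1, fun s hs => hw.2 s (h hs)⟩

theorem one_mem_X (hL : L ⊆ Set.range cs.simple) (hI : I ⊆ L) : 1 ∈ X L I :=
  (mem_X_iff cs hL hI).mpr ⟨one_mem _, fun s _ => cs.not_isRightInversion_one s⟩

theorem X_self (hL : L ⊆ Set.range cs.simple) : X L L = {1} :=
  Set.eq_singleton_iff_unique_mem.mpr ⟨one_mem_X cs hL subset_rfl, fun y hy =>
    eq_of_mem_X cs hL subset_rfl hy (one_mem_X cs hL subset_rfl) (by simpa using hy.1)⟩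

/-- Transitivity of minimal coset representatives. -/
theorem mul_mem_X_iff (hL : L ⊆ Set.range cs.simple) (hK : K ⊆ L) (hI : I ⊆ K) {x u : W}
    (hx : x ∈ X L K) (hu : u ∈ parabolic K) : x * u ∈ X L I ↔ u ∈ X K I := by
  rw [mem_X_iff cs hL (hI.trans hK), mem_X_iff cs (hK.trans hL) hI]
  simp only [mul_mem hx.1 (parabolic_mono hK hu), hu, true_and]
  refine forall₂_congr fun s hs => not_congr ?_
  exact isRightInversion_mul_iff_of_mem_X cs hL hK hx hu (Subgroup.subset_closure (hI hs))

/-! ### Double cosets -/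

theorem mem_X₂_inv {d : W} (h : d ∈ X₂ L K I) : d⁻¹ ∈ X₂ L I K := ⟨by simpa using h.2, h.1⟩

theorem mem_conj_iff {d t : W} : t ∈ conj d I ↔ d⁻¹ * t * d ∈ I := by
  constructor
  · rintro ⟨s, hs, rfl⟩
    simpa [mul_assoc] using hs
  · intro h
    exact ⟨_, h, by simp [mul_assoc]⟩

theorem inter_conj_eq (d : W) : K ∩ conj d I = conj d (I ∩ conj d⁻¹ K) := by
  ext t
  simp [mem_conj_iff, mul_assoc, and_comm]

theorem conj_inv_of_conj_eq {K' : Set W} {d : W} (hc : conj d K' = K) : conj d⁻¹ K = K' := by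
  subst hc
  ext t
  simp [mem_conj_iff, mul_assoc]

/-- Lengths add both in $d\cdot s$ and in $(dsd^{-1})\cdot d$, so $dsd^{-1}$ has length 1. -/
theorem mem_of_conj_mem_parabolic (hL : L ⊆ Set.range cs.simple) (hK : K ⊆ L) (hI : I ⊆ L)
    {d s : W} (hd : d ∈ X₂ L K I) (hs : s ∈ I) (h : d * s * d⁻¹ ∈ parabolic K) :
    d * s * d⁻¹ ∈ K := by
  refine mem_of_mem_parabolic cs (hK.trans hL) h ?_
  have h1 := length_mul_of_mem_X cs hL hK hd.1 (inv_mem h)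
  have h2 := length_mul_of_mem_X cs hL hI hd.2 (Subgroup.subset_closure hs)
  rw [← mul_inv_rev, cs.length_inv, cs.length_inv, cs.length_inv, inv_mul_cancel_right, h2] at h1
  obtain ⟨i, rfl⟩ := hL (hI hs)
  rw [cs.length_simple] at h1
  omega

/-- Mackey decomposition of minimal coset representatives, membership. -/
theorem mul_mem_X_iff_of_mem_X₂ (hL : L ⊆ Set.range cs.simple) (hK : K ⊆ L) (hI : I ⊆ L)
    {d u : W} (hd : d ∈ X₂ L K I) (hu : u ∈ parabolic K) :
    u * d ∈ X L I ↔ u ∈ X K (K ∩ conj d I) := by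
  rw [mem_X_iff cs hL hI, mem_X_iff cs (hK.trans hL) Set.inter_subset_left]
  simp only [mul_mem (parabolic_mono hK hu) hd.2.1, hu, true_and]
  have key : ∀ s ∈ I, cs.IsRightInversion (u * d) s ↔
      cs.IsRightInversion u (d * s * d⁻¹) := by
    intro s hs
    rw [cs.isRightInversion_mul_iff (isReflection_of_mem cs (hI.trans hL) hs)]
    have := ((mem_X_iff cs hL hI).mp hd.2).2 s hs
    tauto
  constructor
  · rintro h _ ⟨-, s, hs, rfl⟩
    exact fun h' => h s hs ((key s hs).mpr h')
  · intro h s hs h'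
    rw [key s hs] at h'
    exact h _ ⟨mem_of_conj_mem_parabolic cs hL hK hI hd hs
      (mem_parabolic_of_isRightInversion cs (hK.trans hL) hu h'), s, hs, rfl⟩ h'

/-- Mackey decomposition of minimal coset representatives, existence. -/
theorem exists_mul_of_mem_X (hL : L ⊆ Set.range cs.simple) (hK : K ⊆ L) (hI : I ⊆ L)
    {w : W} (hw : w ∈ X L I) :
    ∃ d ∈ X₂ L K I, ∃ u ∈ X K (K ∩ conj d I), w = u * d := by
  obtain ⟨y, hy, v, hv, h⟩ := exists_mem_X_mul cs hL hK (inv_mem hw.1)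
  obtain rfl : w = v⁻¹ * y⁻¹ := by rw [← mul_inv_rev, ← h, inv_inv]
  have hd : y⁻¹ ∈ X₂ L K I := by
    refine ⟨by simpa using hy, (mem_X_iff cs hL hI).mpr ⟨inv_mem hy.1, fun s hs hi => ?_⟩⟩
    have h1 := ((mem_X_iff cs hL hI).mp hw).2 s hs
    rw [cs.isRightInversion_mul_iff hi.1] at h1
    have h2 : cs.IsRightInversion v⁻¹ (y⁻¹ * s * y⁻¹⁻¹) := by tauto
    have h3 := mem_parabolic_of_isRightInversion cs (hK.trans hL) (inv_mem hv) h2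
    -- The reflection $y^{-1}sy$ lies in $W_K$, and $y\cdot y^{-1}sy=sy$ would be shorter than $y$,
    -- against the minimality of $y$ in $yW_K$.
    refine not_isRightInversion_of_mem_X cs hL hK hy h3 ⟨h2.1, ?_⟩
    have h4 := hi.2
    rwa [← cs.length_inv, ← cs.length_inv y⁻¹, mul_inv_rev, inv_inv, hi.1.inv,
      show s * y = y * (y⁻¹ * s * y⁻¹⁻¹) by simp [mul_assoc]] at h4
  exact ⟨_, hd, _, (mul_mem_X_iff_of_mem_X₂ cs hL hK hI hd (inv_mem hv)).mp hw, rfl⟩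

theorem eq_of_mul_eq_mul_of_mem_X₂ (hL : L ⊆ Set.range cs.simple) (hK : K ⊆ L)
    {d d' u u' : W} (hd : d ∈ X₂ L K I) (hd' : d' ∈ X₂ L K I) (hu : u ∈ parabolic K)
    (hu' : u' ∈ parabolic K) (h : u * d = u' * d') : u = u' ∧ d = d' := by
  have : d⁻¹ = d'⁻¹ := by
    refine eq_of_mem_X cs hL hK hd.1 hd'.1 ?_
    rw [inv_inv, show d = u⁻¹ * (u' * d') by rw [← h]; group, mul_assoc, mul_inv_cancel_right]
    exact mul_mem (inv_mem hu) hu'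
  have h' := inv_injective this
  subst h'
  exact ⟨mul_right_cancel h, rfl⟩

/-- Intersections of conjugates of parabolic subgroups. -/
theorem mem_parabolic_inter_conj (hL : L ⊆ Set.range cs.simple) (hK : K ⊆ L) (hI : I ⊆ L)
    {d y : W} (hd : d ∈ X₂ L K I) :
    y ∈ parabolic (K ∩ conj d I) ↔ y ∈ parabolic K ∧ d⁻¹ * y * d ∈ parabolic I := by
  have hle : ∀ z ∈ parabolic (K ∩ conj d I), d⁻¹ * z * d ∈ parabolic I := by
    intro z hz
    induction hz using Subgroup.closure_induction with
    | mem z hz => exact Subgroup.subset_closure (mem_conj_iff.mp hz.2)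
    | one => simp
    | mul a b _ _ ha hb => simpa [mul_assoc] using mul_mem ha hb
    | inv a _ ha => simpa [mul_assoc] using inv_mem ha
  refine ⟨fun h => ⟨parabolic_mono Set.inter_subset_left h, hle y h⟩, fun ⟨h1, h2⟩ => ?_⟩
  obtain ⟨z, hz, u, hu, rfl⟩ := exists_mem_X_mul cs (hK.trans hL)
    (Set.inter_subset_left : K ∩ conj d I ⊆ K) h1
  have hzd := (mul_mem_X_iff_of_mem_X₂ cs hL hK hI hd hz.1).mpr hz
  -- Both $d$ and $zd$ lie in $X_I$ and represent the same coset of $W_I$.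
  have h3 : d = z * d := by
    refine eq_of_mem_X cs hL hI hd.2 hzd ?_
    have := mul_mem h2 (inv_mem (hle u hu))
    simpa [mul_assoc] using this
  rw [show z = 1 from right_eq_mul.mp h3, one_mul]
  exact hu

/-- If `d ∈ X_J` conjugates `J` to `J' ⊆ L`, then `X_{J'} d = X_J`. -/
theorem mul_mem_X_iff_of_conj (hL : L ⊆ Set.range cs.simple) (hJ : J ⊆ L) {d w : W}
    (hd : d ∈ X L J) (hc : conj d J ⊆ L) : w * d ∈ X L J ↔ w ∈ X L (conj d J) := by
  rw [mem_X_iff cs hL hJ, mem_X_iff cs hL hc, Subgroup.mul_mem_cancel_right _ hd.1]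
  refine and_congr_right fun _ => ?_
  rw [conj, Set.forall_mem_image]
  refine forall₂_congr fun s hs => not_congr ?_
  rw [cs.isRightInversion_mul_iff (isReflection_of_mem cs (hJ.trans hL) hs)]
  have := ((mem_X_iff cs hL hJ).mp hd).2 s hs
  tauto

/-- Conjugation by `d` maps `X^{K'}_I` to `X^K_{dId⁻¹}` when `dK'd⁻¹ = K`. -/
theorem conj_mem_X_iff {K' : Set W} (hL : L ⊆ Set.range cs.simple) (hK : K ⊆ L) (hK' : K' ⊆ L)
    (hI : I ⊆ K') {d w : W} (hd : d ∈ X L K') (hc : conj d K' = K) (hw : w ∈ parabolic K') :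
    d * w * d⁻¹ ∈ X K (conj d I) ↔ w ∈ X K' I := by
  subst hc
  have hdw : d * w * d⁻¹ ∈ parabolic (conj d K') := by
    induction hw using Subgroup.closure_induction with
    | mem w hw => exact Subgroup.subset_closure ⟨w, hw, rfl⟩
    | one => simp
    | mul a b _ _ ha hb => simpa [mul_assoc] using mul_mem ha hb
    | inv a _ ha => simpa [mul_assoc] using inv_mem ha
  rw [mem_X_iff cs (hK'.trans hL) hI, mem_X_iff cs (hK.trans hL) (show conj d I ⊆ conj d K' from Set.image_mono hI)]
  simp only [hdw, hw, true_and]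
  rw [conj, Set.forall_mem_image]
  refine forall₂_congr fun s hs => not_congr ?_
  have hr := isReflection_of_mem cs (hI.trans (hK'.trans hL)) hs
  have h1 := isRightInversion_mul_iff_of_mem_X cs hL hK' hd hw (Subgroup.subset_closure (hI hs))
  have h2 := not_isRightInversion_of_mem_X cs hL hK' hd (Subgroup.subset_closure (hI hs))
  rw [← inv_mul_cancel_right (d * w) d, cs.isRightInversion_mul_iff hr] at h1
  tauto

end DescentAlgebra

/-! ### Multiplication in the descent algebra -/

namespace DescentAlgebra

variable {B W : Type*} [Group W] [Finite W] {M : CoxeterMatrix B} (cs : CoxeterSystem M W)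
  {L K I J : Set W}

open MonoidAlgebra

theorem x_eq_sum_of_bijOn {A : Set W} {ι : Type*} (s : Finset ι) (f : ι → W)
    (h : Set.BijOn f s A) :
    ∑ w ∈ A.toFinite.toFinset, of ℚ W w = ∑ i ∈ s, of ℚ W (f i) := by
  refine (Finset.sum_nbij f ?_ h.injOn ?_ fun _ _ => rfl).symm
  · intro i hi
    simpa using h.mapsTo hi
  · simpa using h.surjOn

theorem x_self (hL : L ⊆ Set.range cs.simple) : x L L = 1 := by
  rw [x, x_eq_sum_of_bijOn {(1 : W)} id]
  · rw [Finset.sum_singleton, id, map_one]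
  · simp [X_self cs hL]

theorem x_mul_x_of_subset (hL : L ⊆ Set.range cs.simple) (hK : K ⊆ L) (hI : I ⊆ K) :
    x L K * x K I = x L I := by
  rw [x, x, x, Finset.sum_mul_sum, ← Finset.sum_product',
    x_eq_sum_of_bijOn (A := X L I)
      ((X L K).toFinite.toFinset ×ˢ (X K I).toFinite.toFinset) (fun p => p.1 * p.2)]
  · simp
  simp only [Finset.coe_product, Set.Finite.coe_toFinset]
  refine ⟨?_, ?_, ?_⟩
  · rintro ⟨a, b⟩ ⟨ha, hb⟩
    exact (mul_mem_X_iff cs hL hK hI ha hb.1).mpr hb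
  · rintro ⟨a, b⟩ ⟨ha, hb⟩ ⟨a', b'⟩ ⟨ha', hb'⟩ h
    simp only at ha hb ha' hb' h
    have : a = a' := by
      refine eq_of_mem_X cs hL hK ha ha' ?_
      rw [show a⁻¹ * a' = b * b'⁻¹ by
        rw [eq_mul_inv_iff_mul_eq, mul_assoc, ← h, inv_mul_cancel_left]]
      exact mul_mem hb.1 (inv_mem hb'.1)
    subst this
    rw [mul_left_cancel h]
  · intro w hw
    obtain ⟨a, ha, b, hb, rfl⟩ := exists_mem_X_mul cs hL hK hw.1
    exact ⟨(a, b), ⟨ha, (mul_mem_X_iff cs hL hK hI ha hb).mp hw⟩, rfl⟩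

/-- The Mackey decomposition of $X_I$, summed in the group algebra. -/
theorem x_eq_sum_X₂ (hL : L ⊆ Set.range cs.simple) (hK : K ⊆ L) (hI : I ⊆ L) :
    x L I = ∑ d ∈ (X₂ L K I).toFinite.toFinset, x K (K ∩ conj d I) * of ℚ W d := by
  simp only [x, Finset.sum_mul, ← map_mul]
  rw [Finset.sum_sigma', x_eq_sum_of_bijOn (A := X L I) _
    (fun p : (_ : W) × W => p.2 * p.1)]
  refine ⟨?_, ?_, ?_⟩
  · rintro ⟨d, u⟩ h
    simp only [Finset.coe_sigma, Set.mem_sigma_iff, Set.Finite.coe_toFinset] at h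
    exact (mul_mem_X_iff_of_mem_X₂ cs hL hK hI h.1 h.2.1).mpr h.2
  · rintro ⟨d, u⟩ h ⟨d', u'⟩ h' he
    simp only [Finset.coe_sigma, Set.mem_sigma_iff, Set.Finite.coe_toFinset] at h h'
    obtain ⟨rfl, rfl⟩ := eq_of_mul_eq_mul_of_mem_X₂ cs hL hK h.1 h'.1 h.2.1 h'.2.1 he
    rfl
  · intro w hw
    obtain ⟨d, hd, u, hu, rfl⟩ := exists_mul_of_mem_X cs hL hK hI hw
    exact ⟨⟨d, u⟩, by simpa using ⟨hd, hu⟩, rfl⟩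

theorem x_conj_mul_of (hL : L ⊆ Set.range cs.simple) (hJ : J ⊆ L) {d : W}
    (hd : d ∈ X L J) (hc : conj d J ⊆ L) : x L (conj d J) * of ℚ W d = x L J := by
  simp only [x, Finset.sum_mul, ← map_mul]
  rw [← x_eq_sum_of_bijOn]
  rw [Set.Finite.coe_toFinset]
  refine ⟨fun w hw => (mul_mem_X_iff_of_conj cs hL hJ hd hc).mpr hw,
    (mul_left_injective d).injOn, fun w hw => ⟨w * d⁻¹, ?_, by simp⟩⟩
  rw [← mul_mem_X_iff_of_conj cs hL hJ hd hc]
  simpa using hw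

/-- Solomon's multiplication formula. -/
theorem x_mul_x (hL : L ⊆ Set.range cs.simple) (hK : K ⊆ L) (hI : I ⊆ L) :
    x L I * x L K = ∑ d ∈ (X₂ L K I).toFinite.toFinset, x L (K ∩ conj d I) := by
  rw [x_eq_sum_X₂ cs hL hI hK, Finset.mul_sum]
  -- Expanding $x_K$ along $W_I$ indexes by $d\in X_{IK}$, while the claim uses $X_{KI}$. The left
  -- factor $x_I$ absorbs $x^I_{I\cap dKd^{-1}}$, and right multiplication by $d$ then conjugates
  -- the index set into $K$.
  refine Finset.sum_nbij' (·⁻¹) (·⁻¹) ?_ ?_ (by simp) (by simp) ?_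
  · intro d hd
    simpa using mem_X₂_inv (by simpa using hd)
  · intro d hd
    simpa using mem_X₂_inv (by simpa using hd)
  · intro d hd
    have hd' : d ∈ X₂ L I K := by simpa using hd
    rw [← mul_assoc, x_mul_x_of_subset cs hL hI Set.inter_subset_left, inter_conj_eq,
      x_conj_mul_of cs hL (Set.inter_subset_left.trans hK) (X_anti Set.inter_subset_left hd'.2)]
    rw [← inter_conj_eq]
    exact Set.inter_subset_left.trans hI

theorem one_mem_descent (hL : L ⊆ Set.range cs.simple) : 1 ∈ descent L :=
  x_self cs hL ▸ x_mem subset_rfl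

theorem mul_mem_descent (hL : L ⊆ Set.range cs.simple) {y z : ℚ[W]} (hy : y ∈ descent L)
    (hz : z ∈ descent L) : y * z ∈ descent L := by
  have h : descent L * descent L ≤ descent L := by
    conv_lhs => rw [descent, Submodule.span_mul_span]
    rw [Submodule.span_le]
    rintro _ ⟨_, ⟨⟨I, hI⟩, rfl⟩, _, ⟨⟨K, hK⟩, rfl⟩, rfl⟩
    simp only [SetLike.mem_coe]
    rw [x_mul_x cs hL hK hI]
    exact sum_mem fun d _ => x_mem (Set.inter_subset_left.trans hK)
  exact h (Submodule.mul_mem_mul hy hz)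

/-! ### Linear independence -/

open Classical in
theorem coeff_x (w : W) : (x L I).coeff w = if w ∈ X L I then 1 else 0 := by
  simp [x, coeff_sum, Finsupp.single_apply]

theorem exists_ascents_eq (hL : L ⊆ Set.range cs.simple) (A : Set W) :
    ∃ w ∈ parabolic L, ∀ s ∈ L, ¬cs.IsRightInversion w s ↔ s ∈ A := by
  -- A longest element of $W_{L\setminus A}$ has every element of $L\setminus A$ as a descent, and
  -- no others in $L$, as its inversions stay in that subgroup.
  obtain ⟨w, hw⟩ := Finite.exists_max fun w : parabolic (L \ A) => cs.length (w : W)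
  refine ⟨w, parabolic_mono Set.sdiff_subset w.2, fun s hs => ?_⟩
  have hr := isReflection_of_mem cs hL hs
  constructor
  · intro h
    by_contra hsA
    have h1 := hw (w * ⟨s, Subgroup.subset_closure ⟨hs, hsA⟩⟩)
    have h2 := hr.length_mul_left_ne w
    exact h ⟨hr, lt_of_le_of_ne h1 h2⟩
  · intro hsA h
    have h1 := mem_parabolic_of_isRightInversion cs (Set.sdiff_subset.trans hL) w.2 h
    obtain ⟨i, rfl⟩ := hL hs
    exact (mem_of_mem_parabolic cs (Set.sdiff_subset.trans hL) h1 (cs.length_simple i)).2 hsA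

/-- Triangularity: at an element whose ascent set in $L$ is exactly $A$, the coefficient of $x_I$ is
nonzero only for $I\subseteq A$. Induction on $A$ then kills the coefficients. -/
theorem linearIndependent_x (hL : L ⊆ Set.range cs.simple) :
    LinearIndependent ℚ fun I : {I : Set W // I ⊆ L} => x L I := by
  classical
  have := Fintype.ofFinite {I : Set W // I ⊆ L}
  rw [Fintype.linearIndependent_iff]
  intro g hg A
  induction A using (Finite.wellFounded_of_trans_of_irrefl
    (· < · : {I : Set W // I ⊆ L} → _ → Prop)).induction with
  | _ A ih =>
  obtain ⟨w, hw, hwA⟩ := exists_ascents_eq cs hL A.1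
  have h := congrArg (fun z : ℚ[W] => z.coeff w) hg
  simp only [coeff_sum, Finsupp.finsetSum_apply, coeff_smul, Finsupp.smul_apply, coeff_x,
    coeff_zero, Finsupp.zero_apply] at h
  rw [Finset.sum_eq_single A] at h
  · rw [if_pos ((mem_X_iff cs hL A.2).mpr ⟨hw, fun s hs => (hwA s (A.2 hs)).mpr hs⟩)] at h
    simpa using h
  · intro I _ hI
    split_ifs with h1
    · have hIA : I.1 ⊆ A.1 := fun s hs =>
        (hwA s (I.2 hs)).mp (((mem_X_iff cs hL I.2).mp h1).2 s hs)
      rw [ih I (lt_of_le_of_ne hIA hI), zero_smul]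
    · exact smul_zero _
  · simp

theorem linearExtension_apply (hL : L ⊆ Set.range cs.simple) {V : Type*} [AddCommGroup V]
    [Module ℚ V] (v : {I : Set W // I ⊆ L} → V) (I : {I : Set W // I ⊆ L}) :
    linearExtension L v ⟨x L I, x_mem I.2⟩ = v I := by
  have h : ∃ f : descent L →ₗ[ℚ] V, ∀ I : {I : Set W // I ⊆ L}, f ⟨x L I, x_mem I.2⟩ = v I := by
    let b := Module.Basis.span (linearIndependent_x cs hL)
    refine ⟨b.constr ℚ v, fun I => ?_⟩
    rw [← b.constr_basis ℚ v I]
    congr 1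
    exact (Module.Basis.span_apply (linearIndependent_x cs hL) I).symm
  rw [linearExtension, dif_pos h]
  exact h.choose_spec I

theorem res_x (hL : L ⊆ Set.range cs.simple) (K : Set W) (hI : I ⊆ L) :
    (res L K ⟨x L I, x_mem hI⟩ : ℚ[W]) =
      ∑ d ∈ (X₂ L K I).toFinite.toFinset, x K (K ∩ conj d I) := by
  rw [res, linearExtension_apply cs hL _ ⟨I, hI⟩]
  simp

theorem θ_x (hL : L ⊆ Set.range cs.simple) (hI : I ⊆ L) :
    θ L ⟨x L I, x_mem hI⟩ = inducedTrivial L ⟨I, hI⟩ :=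
  linearExtension_apply cs hL _ ⟨I, hI⟩

/-- Linear maps on `Σ(W_L)` that agree on the `x_I` are equal. -/
theorem descent_hom_ext {V : Type*} [AddCommGroup V] [Module ℚ V] {f g : descent L →ₗ[ℚ] V}
    (h : ∀ (I : Set W) (hI : I ⊆ L), f ⟨x L I, x_mem hI⟩ = g ⟨x L I, x_mem hI⟩) : f = g := by
  ext ⟨y, hy⟩
  induction hy using Submodule.span_induction with
  | mem y hy => obtain ⟨⟨I, hI⟩, rfl⟩ := hy; exact h I hI
  | zero => exact (map_zero f).trans (map_zero g).symm
  | add a b ha hb iha ihb =>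
    exact (map_add f ⟨a, ha⟩ ⟨b, hb⟩).trans
      ((congrArg₂ (· + ·) iha ihb).trans (map_add g ⟨a, ha⟩ ⟨b, hb⟩).symm)
  | smul c a ha iha =>
    exact (map_smul f c ⟨a, ha⟩).trans
      ((congrArg (c • ·) iha).trans (map_smul g c ⟨a, ha⟩).symm)

/-! ### The restriction homomorphism -/

theorem x_mul_res (hL : L ⊆ Set.range cs.simple) (hK : K ⊆ L) (y : descent L) :
    x L K * (res L K y : ℚ[W]) = (y : ℚ[W]) * x L K := by
  have : LinearMap.mulLeft ℚ (x L K) ∘ₗ (descent K).subtype ∘ₗ res L K =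
      LinearMap.mulRight ℚ (x L K) ∘ₗ (descent L).subtype := by
    refine descent_hom_ext fun I hI => ?_
    simp only [LinearMap.comp_apply, Submodule.subtype_apply, LinearMap.mulLeft_apply,
      LinearMap.mulRight_apply]
    rw [res_x cs hL K hI, x_mul_x cs hL hK hI, Finset.mul_sum]
    exact Finset.sum_congr rfl fun d _ => x_mul_x_of_subset cs hL hK Set.inter_subset_left
  exact LinearMap.congr_fun this y

theorem coeff_eq_zero_of_mem_descent {z : ℚ[W]} (hz : z ∈ descent K) {w : W}
    (hw : w ∉ parabolic K) : z.coeff w = 0 := by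
  classical
  induction hz using Submodule.span_induction with
  | mem z hz =>
    obtain ⟨I, rfl⟩ := hz
    simp only [coeff_x]
    exact if_neg fun h => hw h.1
  | zero => simp
  | add a b _ _ ha hb => simp [ha, hb]
  | smul c a _ ha => simp [ha]

/-- Only the summand $1$ of $x_K$ contributes: any other $d\in X_K$ moves $W_K$ to a different
coset. -/
theorem coeff_x_mul (hL : L ⊆ Set.range cs.simple) (hK : K ⊆ L) {z : ℚ[W]}
    (hz : z ∈ descent K) {w : W} (hw : w ∈ parabolic K) : (x L K * z).coeff w = z.coeff w := by
  simp only [x, Finset.sum_mul, coeff_sum, Finsupp.finsetSum_apply, of_apply,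
    coeff_single_mul_apply, one_mul]
  rw [Finset.sum_eq_single 1]
  · simp
  · intro d hd hd1
    refine coeff_eq_zero_of_mem_descent hz fun h => hd1 ?_
    rw [Subgroup.mul_mem_cancel_right _ hw] at h
    exact eq_of_mem_X cs hL hK (by simpa using hd) (one_mem_X cs hL hK) (by simpa using h)
  · intro h
    exact absurd (by simpa using one_mem_X cs hL hK) h

theorem x_mul_injOn (hL : L ⊆ Set.range cs.simple) (hK : K ⊆ L) :
    Set.InjOn (x L K * ·) (descent K : Set ℚ[W]) := by
  intro y hy z hz h
  ext w
  by_cases hw : w ∈ parabolic K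
  · rw [← coeff_x_mul cs hL hK hy hw, ← coeff_x_mul cs hL hK hz hw]
    exact congrArg (fun z : ℚ[W] => z.coeff w) h
  · rw [coeff_eq_zero_of_mem_descent hy hw, coeff_eq_zero_of_mem_descent hz hw]

/-- `Res_K(y)` is the only element `z` of `Σ(W_K)` with `x_K z = y x_K`. -/
theorem res_eq (hL : L ⊆ Set.range cs.simple) (hK : K ⊆ L) {y : descent L} {z : ℚ[W]}
    (hz : z ∈ descent K) (h : x L K * z = (y : ℚ[W]) * x L K) : (res L K y : ℚ[W]) = z :=
  x_mul_injOn cs hL hK (res L K y).2 hz ((x_mul_res cs hL hK y).trans h.symm)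

theorem res_one (hL : L ⊆ Set.range cs.simple) (hK : K ⊆ L) :
    (res L K ⟨1, one_mem_descent cs hL⟩ : ℚ[W]) = 1 :=
  res_eq cs hL hK (one_mem_descent cs (hK.trans hL)) (by simp)

theorem res_mul (hL : L ⊆ Set.range cs.simple) (hK : K ⊆ L) (y z : descent L) :
    (res L K ⟨y * z, mul_mem_descent cs hL y.2 z.2⟩ : ℚ[W]) = res L K y * res L K z :=
  res_eq cs hL hK (mul_mem_descent cs (hK.trans hL) (res L K y).2 (res L K z).2) (by
    rw [← mul_assoc, x_mul_res cs hL hK, mul_assoc, x_mul_res cs hL hK, mul_assoc])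

theorem res_comp_res {S : Set W} (hS : S ⊆ Set.range cs.simple) (hL : L ⊆ S) (hK : K ⊆ L) :
    res S K = (res L K).comp (res S L) := by
  ext1 y
  refine Subtype.ext (res_eq cs hS (hK.trans hL) (res L K _).2 ?_)
  -- Factor $x_K=x_L\,x_K^L$ and move $y$ past the two factors in turn.
  rw [← x_mul_x_of_subset cs hS hL hK, LinearMap.comp_apply, mul_assoc,
    x_mul_res cs (hL.trans hS) hK, ← mul_assoc, x_mul_res cs hS hL, mul_assoc]

theorem res_eq_zero_iff (hL : L ⊆ Set.range cs.simple) (hK : K ⊆ L) (y : descent L) :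
    res L K y = 0 ↔ (y : ℚ[W]) * x L K = 0 := by
  constructor
  · intro h
    rw [← x_mul_res cs hL hK, h, ZeroMemClass.coe_zero, mul_zero]
  · intro h
    exact Subtype.ext (res_eq cs hL hK (zero_mem _) ((mul_zero _).trans h.symm))

/-! ### Conjugation -/

theorem of_mul_x_mul_of {K' : Set W} (hL : L ⊆ Set.range cs.simple) (hK : K ⊆ L) (hK' : K' ⊆ L)
    (hI : I ⊆ K') {d : W} (hd : d ∈ X L K') (hc : conj d K' = K) :
    of ℚ W d * x K' I * of ℚ W d⁻¹ = x K (conj d I) := by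
  simp only [x, Finset.sum_mul, Finset.mul_sum, ← map_mul]
  rw [← x_eq_sum_of_bijOn]
  rw [Set.Finite.coe_toFinset]
  refine ⟨fun w hw => (conj_mem_X_iff cs hL hK hK' hI hd hc hw.1).mpr hw,
    fun a _ b _ h => by simpa using h, fun w hw => ⟨d⁻¹ * w * d, ?_, by simp [mul_assoc]⟩⟩
  have hw' : d⁻¹ * w * d ∈ parabolic K' := by
    have := hw.1
    subst hc
    clear hw
    induction this using Subgroup.closure_induction with
    | mem w hw => exact Subgroup.subset_closure (mem_conj_iff.mp hw)
    | one => simp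
    | mul a b _ _ ha hb => simpa [mul_assoc] using mul_mem ha hb
    | inv a _ ha => simpa [mul_assoc] using inv_mem ha
  rw [← conj_mem_X_iff cs hL hK hK' hI hd hc hw']
  simpa [mul_assoc] using hw

theorem of_mul_mem_descent {K' : Set W} (hL : L ⊆ Set.range cs.simple) (hK : K ⊆ L)
    (hK' : K' ⊆ L) {d : W} (hd : d ∈ X L K') (hc : conj d K' = K) {z : ℚ[W]}
    (hz : z ∈ descent K') : of ℚ W d * z * of ℚ W d⁻¹ ∈ descent K := by
  induction hz using Submodule.span_induction with
  | mem z hz =>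
    obtain ⟨⟨I, hI⟩, rfl⟩ := hz
    simp only
    rw [of_mul_x_mul_of cs hL hK hK' hI hd hc]
    exact x_mem (hc ▸ Set.image_mono hI)
  | zero => simp
  | add a b _ _ ha hb => rw [mul_add, add_mul]; exact add_mem ha hb
  | smul c a _ ha =>
    rw [mul_smul_comm, smul_mul_assoc]
    exact Submodule.smul_mem _ _ ha

theorem res_eq_conj {K' : Set W} (hL : L ⊆ Set.range cs.simple) (hK : K ⊆ L)
    (hK' : K' ⊆ L) {d : W} (hd : d ∈ X L K') (hc : conj d K' = K) (y : descent L) :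
    (res L K y : ℚ[W]) = of ℚ W d * res L K' y * of ℚ W d⁻¹ := by
  refine res_eq cs hL hK (of_mul_mem_descent cs hL hK hK' hd hc (res L K' y).2) ?_
  -- The relation $x_K d=x_{K'}$ turns the defining equation for $K'$ into the one for $K$.
  have h := x_conj_mul_of cs hL hK' hd (hc ▸ hK)
  rw [hc] at h
  rw [← mul_assoc, ← mul_assoc, h, x_mul_res cs hL hK', ← h, mul_assoc, mul_assoc, ← map_mul, mul_inv_cancel, map_one,
    mul_one]

/-! ### The direct sum decomposition -/

/-- If `u` is a sum of elements `x_J^K` among which `x_K^K = 1` occurs, then `u` is right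
invertible in `Σ(W_K)`. -/
theorem exists_right_inverse (hK : K ⊆ Set.range cs.simple) {ι : Type*} (s : Finset ι)
    (J : ι → Set W) (hJ : ∀ i ∈ s, J i ⊆ K) {i₀ : ι} (hi₀ : i₀ ∈ s) (h₀ : J i₀ = K) :
    ∃ v ∈ descent K, (∑ i ∈ s, x K (J i)) * v = 1 := by
  classical
  set u := ∑ i ∈ s, x K (J i) with hu
  -- It suffices that $u\Sigma(W_K)$ contains every $x_I^K$, in particular $x_K^K=1$. By Solomon's
  -- formula $u\,x_I^K$ is a multiple of $x_I^K$ plus terms for proper subsets of $I$, so induct on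
  -- $|I|$.
  suffices H : ∀ (n : ℕ) (I : Set W), I ⊆ K → I.ncard = n →
      x K I ∈ (descent K).map (LinearMap.mulLeft ℚ u) by
    obtain ⟨v, hv, h⟩ := H _ K subset_rfl rfl
    exact ⟨v, hv, by rw [← x_self cs hK, ← h, LinearMap.mulLeft_apply]⟩
  intro n
  induction n using Nat.strong_induction_on with
  | _ n ih =>
  rintro I hI rfl
  have hsum : u * x K I =
      ∑ p ∈ s.sigma fun i => (X₂ K I (J i)).toFinite.toFinset, x K (I ∩ conj p.2 (J p.1)) := by
    rw [Finset.sum_sigma, hu, Finset.sum_mul]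
    exact Finset.sum_congr rfl fun i hi => x_mul_x cs hK hI (hJ i hi)
  have hmem : u * x K I ∈ (descent K).map (LinearMap.mulLeft ℚ u) := ⟨_, x_mem hI, rfl⟩
  rw [hsum, ← Finset.sum_filter_add_sum_filter_not _
    (fun p : (_ : ι) × W => I ∩ conj p.2 (J p.1) = I)] at hmem
  have h2 := (Submodule.add_mem_iff_left _ (sum_mem fun p hp => ih _ ?_ _
    (Set.inter_subset_left.trans hI) rfl)).mp hmem
  · rw [Finset.sum_congr rfl fun p hp => by rw [(Finset.mem_filter.mp hp).2],
      Finset.sum_const, ← Nat.cast_smul_eq_nsmul ℚ] at h2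
    refine (Submodule.smul_mem_iff _ ?_).mp h2
    rw [Nat.cast_ne_zero]
    -- The multiplicity of $x_I^K$ is nonzero because the summand $x_K^K$ with $d=1$ contributes.
    refine Finset.card_ne_zero_of_mem (a := ⟨i₀, 1⟩) ?_
    simp only [Finset.mem_filter, Finset.mem_sigma, Set.Finite.mem_toFinset, hi₀, true_and, h₀]
    refine ⟨⟨by simpa using one_mem_X cs hK hI, one_mem_X cs hK subset_rfl⟩, ?_⟩
    simpa [conj] using hI
  · exact Set.ncard_lt_ncard
      (lt_of_le_of_ne Set.inter_subset_left (Finset.mem_filter.mp hp).2) I.toFinite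

/-- The hypothesis says $\mathrm{Res}_K(y)\,\mathrm{Res}_K(x_K)=0$; cancelling the right invertible
second factor gives $\mathrm{Res}_K(y)=0$. -/
theorem mul_x_eq_zero (hL : L ⊆ Set.range cs.simple) (hK : K ⊆ L) {y : ℚ[W]}
    (hy : y ∈ descent L) (h : y * x L K * x L K = 0) : y * x L K = 0 := by
  have hxK : x L K ∈ descent L := x_mem hK
  obtain ⟨v, hv, huv⟩ := exists_right_inverse cs (hK.trans hL) (X₂ L K K).toFinite.toFinset
    (fun d => K ∩ conj d K) (fun _ _ => Set.inter_subset_left) (i₀ := 1)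
    (by simpa [X₂] using one_mem_X cs hL hK) (by simp [conj])
  rw [← res_x cs hL K hK] at huv
  have h1 := (res_eq_zero_iff cs hL hK ⟨y * x L K, mul_mem_descent cs hL hy hxK⟩).mpr h
  have h2 := res_mul cs hL hK ⟨y, hy⟩ ⟨x L K, hxK⟩
  rw [h1, ZeroMemClass.coe_zero] at h2
  have h3 : (res L K ⟨y, hy⟩ : ℚ[W]) = 0 := by
    rw [← mul_one (res L K ⟨y, hy⟩ : ℚ[W]), ← huv, ← mul_assoc, ← h2, zero_mul]
  exact (res_eq_zero_iff cs hL hK ⟨y, hy⟩).mp (Subtype.ext h3)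

theorem map_mulRight_le (hL : L ⊆ Set.range cs.simple) (hK : K ⊆ L) :
    (descent L).map (LinearMap.mulRight ℚ (x L K)) ≤ descent L := by
  rintro _ ⟨y, hy, rfl⟩
  exact mul_mem_descent cs hL hy (x_mem hK)

theorem isCompl_ker_res (hL : L ⊆ Set.range cs.simple) (hK : K ⊆ L) :
    IsCompl (LinearMap.ker (res L K))
      (((descent L).map (LinearMap.mulRight ℚ (x L K))).comap (descent L).subtype) := by
  let g : descent L →ₗ[ℚ] descent L := (LinearMap.mulRight ℚ (x L K)).restrict
    fun y hy => map_mulRight_le cs hL hK ⟨y, hy, rfl⟩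
  have hker : LinearMap.ker (res L K) = LinearMap.ker g := by
    ext y
    rw [LinearMap.mem_ker, LinearMap.mem_ker, res_eq_zero_iff cs hL hK, ← Subtype.coe_inj]
    rfl
  have hrange : ((descent L).map (LinearMap.mulRight ℚ (x L K))).comap (descent L).subtype =
      LinearMap.range g := by
    ext y
    constructor
    · rintro ⟨z, hz, h⟩
      exact ⟨⟨z, hz⟩, Subtype.ext h⟩
    · rintro ⟨z, rfl⟩
      exact ⟨z, z.2, rfl⟩
  rw [hker, hrange]
  have : FiniteDimensional ℚ (descent L) :=
    FiniteDimensional.span_of_finite ℚ (Set.finite_range _)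
  have hd : Disjoint (LinearMap.ker g) (LinearMap.range g) := by
    rw [Submodule.disjoint_def]
    rintro _ h ⟨z, rfl⟩
    exact Subtype.ext (mul_x_eq_zero cs hL hK z.2 (congrArg Subtype.val h))
  refine ⟨hd, codisjoint_iff.mpr (Submodule.eq_top_of_disjoint _ _ ?_ hd)⟩
  rw [add_comm, g.finrank_range_add_finrank_ker]

end DescentAlgebra

/-! ### Induced trivial characters -/

namespace Representation

variable {G H : Type*} [Group G] [Group H] (φ : G →* H)

theorem IndV.mk_trivial_mul (k : Type*) [CommRing k] (x : G) (h : H) (a : k) :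
    IndV.mk φ (trivial k G k) (φ x * h) a = IndV.mk φ (trivial k G k) h a := by
  have := Coinvariants.mk_self_apply
    (Representation.tprod ((leftRegular k H).comp φ) (trivial k G k)) x
    (TensorProduct.tmul k (MonoidAlgebra.single h 1) a)
  simpa using this

/-- The linear map `⟦h ⊗ a⟧ ↦ a [h⁻¹]` from the representation induced from the trivial
representation to the permutation representation on the cosets. -/
noncomputable def indTrivialToFinsupp (k : Type*) [CommRing k] :
    IndV φ (trivial k G k) →ₗ[k] (H ⧸ φ.range →₀ k) :=
  Coinvariants.lift _
    -- Coinvariants identify $h$ with $\varphi(x)h$; inversion turns these classes into left cosets.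
    (TensorProduct.lift ((Finsupp.lift _ _ _ fun h : H =>
      Finsupp.lsingle (R := k) (M := k) ((h⁻¹ : H) : H ⧸ φ.range)) ∘ₗ
        (MonoidAlgebra.coeffLinearEquiv k).toLinearMap))
    (fun x => by
      refine TensorProduct.ext <| MonoidAlgebra.lhom_ext' fun h => LinearMap.ext_ring <|
        LinearMap.ext_ring ?_
      have : ((h⁻¹ * (φ x)⁻¹ : H) : H ⧸ φ.range) = ((h⁻¹ : H) : H ⧸ φ.range) := by
        rw [QuotientGroup.eq]
        exact ⟨x, by simp⟩
      simp [this])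

theorem indTrivialToFinsupp_mk (k : Type*) [CommRing k] (h : H) (a : k) :
    indTrivialToFinsupp φ k (IndV.mk φ (trivial k G k) h a) =
      Finsupp.single ((h⁻¹ : H) : H ⧸ φ.range) a := by
  simp [indTrivialToFinsupp]

/-- The representation induced from the trivial representation is the permutation representation
on the cosets. -/
noncomputable def indTrivialEquiv (k : Type*) [CommRing k] :
    IndV φ (trivial k G k) ≃ₗ[k] (H ⧸ φ.range →₀ k) :=
  LinearEquiv.ofLinearMap (indTrivialToFinsupp φ k)
    (Finsupp.lsum k fun q => IndV.mk φ (trivial k G k) q.out⁻¹)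
    (by
      ext q : 2
      rw [LinearMap.comp_apply, LinearMap.comp_apply, Finsupp.lsingle_apply, Finsupp.lsum_single,
        indTrivialToFinsupp_mk]
      simp)
    (by
      refine IndV.hom_ext _ _ fun h => LinearMap.ext fun a => ?_
      rw [LinearMap.comp_apply, LinearMap.comp_apply, indTrivialToFinsupp_mk, Finsupp.lsum_single]
      obtain ⟨⟨_, x, rfl⟩, hx⟩ := QuotientGroup.mk_out_eq_mul φ.range h⁻¹
      rw [hx, mul_inv_rev, inv_inv, ← map_inv, IndV.mk_trivial_mul]
      rfl)

theorem indTrivialEquiv_mk (k : Type*) [CommRing k] (h : H) (a : k) :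
    indTrivialEquiv φ k (IndV.mk φ (trivial k G k) h a) =
      Finsupp.single ((h⁻¹ : H) : H ⧸ φ.range) a :=
  indTrivialToFinsupp_mk φ k h a

theorem indTrivialEquiv_conj (k : Type*) [CommRing k] (g : H) :
    (indTrivialEquiv φ k).conj (ind φ (trivial k G k) g) = Finsupp.lmapDomain k k (g • ·) := by
  ext q : 2
  induction q using QuotientGroup.induction_on with
  | H h =>
  rw [LinearMap.comp_apply, LinearEquiv.conj_apply_apply, Finsupp.lsingle_apply,
    ← inv_inv h, ← indTrivialEquiv_mk, LinearEquiv.symm_apply_apply, ind_mk, indTrivialEquiv_mk]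
  simp

/-- The trace of a permutation matrix counts fixed points. -/
theorem character_ind_trivial [Finite H] (k : Type*) [Field k] (g : H) :
    (ind φ (trivial k G k)).character g = Nat.card {q : H ⧸ φ.range // g • q = q} := by
  classical
  have := Fintype.ofFinite (H ⧸ φ.range)
  rw [character, ← LinearMap.trace_conj' _ (indTrivialEquiv φ k), indTrivialEquiv_conj,
    LinearMap.trace_eq_matrix_trace k Finsupp.basisSingleOne, Matrix.trace]
  simp [LinearMap.toMatrix_apply, Finsupp.single_apply, Fintype.card_subtype]

end Representation

/-! ### Restriction of induced trivial characters (Mackey) -/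

namespace DescentAlgebra

variable {B W : Type*} [Group W] [Finite W] {M : CoxeterMatrix B} (cs : CoxeterSystem M W)
  {L K I : Set W}

/-- The set $X_I^L$ represents the cosets $W_L/W_I$, and $g$ fixes $wW_I$ exactly when $w^{-1}gw\in
W_I$. -/
theorem inducedTrivial_apply (hL : L ⊆ Set.range cs.simple) (hI : I ⊆ L) (g : parabolic L) :
    (inducedTrivial L ⟨I, hI⟩).1 g = Nat.card {w : W // w ∈ X L I ∧ w⁻¹ * g * w ∈ parabolic I} := by
  have hr : ∀ h : parabolic L,
      h ∈ (Subgroup.inclusion (parabolic_mono hI)).range ↔ (h : W) ∈ parabolic I := by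
    intro h
    constructor
    · rintro ⟨u, rfl⟩
      exact u.2
    · intro hu
      exact ⟨⟨h, hu⟩, rfl⟩
  refine (Representation.character_ind_trivial _ ℂ g).trans (congrArg _ (Eq.symm ?_))
  refine Nat.card_eq_of_bijective
    (fun w => ⟨((⟨w.1, w.2.1.1⟩ : parabolic L) : parabolic L ⧸ _), ?_⟩) ⟨?_, ?_⟩
  · have h1 := (hr ((⟨w.1, w.2.1.1⟩ : parabolic L)⁻¹ * g * ⟨w.1, w.2.1.1⟩)).mpr w.2.2
    rw [mul_assoc] at h1
    exact (QuotientGroup.eq.mpr h1).symm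
  · rintro ⟨w, hw⟩ ⟨w', hw'⟩ h
    have h1 := QuotientGroup.eq.mp (congrArg Subtype.val h)
    exact Subtype.ext (eq_of_mem_X cs hL hI hw.1 hw'.1 ((hr _).mp h1))
  · rintro ⟨q, hq⟩
    induction q using QuotientGroup.induction_on with
    | H h =>
    obtain ⟨w, hw, u, hu, hwu⟩ := exists_mem_X_mul cs hL hI h.2
    have hwh : ((⟨w, hw.1⟩ : parabolic L) : parabolic L ⧸
        (Subgroup.inclusion (parabolic_mono hI)).range) = (h : parabolic L ⧸ _) := by
      rw [QuotientGroup.eq, hr]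
      simpa [hwu] using hu
    refine ⟨⟨w, hw, ?_⟩, Subtype.ext hwh⟩
    rw [← hwh] at hq
    have h1 := (hr _).mp (QuotientGroup.eq.mp hq.symm)
    simpa [mul_assoc] using h1

theorem restrict_comp_θ (hL : L ⊆ Set.range cs.simple) (hK : K ⊆ L) :
    (CharacterSpace.restrict (Subgroup.inclusion (Subgroup.closure_mono hK))).comp (θ L) =
      (θ K).comp (res L K) := by
  refine descent_hom_ext fun I hI => ?_
  have hres : res L K ⟨x L I, x_mem hI⟩ = ∑ d ∈ (X₂ L K I).toFinite.toFinset,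
      ⟨x K (K ∩ conj d I), x_mem Set.inter_subset_left⟩ :=
    Subtype.ext ((res_x cs hL K hI).trans (by simp))
  rw [LinearMap.comp_apply, LinearMap.comp_apply, hres, map_sum, θ_x cs hL hI]
  have hθ : ∀ d, θ K ⟨x K (K ∩ conj d I), x_mem Set.inter_subset_left⟩ =
      inducedTrivial K ⟨K ∩ conj d I, Set.inter_subset_left⟩ := fun d =>
    θ_x cs (hK.trans hL) Set.inter_subset_left
  simp only [hθ]
  refine Subtype.ext (funext fun g => ?_)
  rw [Submodule.coe_sum, Finset.sum_apply]
  simp only [inducedTrivial_apply cs (hK.trans hL)]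
  refine (inducedTrivial_apply cs hL hI _).trans ?_
  rw [← Nat.cast_sum]
  congr 1
  rw [← Finset.sum_coe_sort, ← Nat.card_sigma]
  symm
  have hd : ∀ d : (X₂ L K I).toFinite.toFinset, d.1 ∈ X₂ L K I := fun d => (Set.Finite.mem_toFinset _).mp d.2
  -- As $u^{-1}gu$ already lies in $W_K$, membership in $W_{K\cap dId^{-1}}=W_K\cap dW_Id^{-1}$ only
  -- tests the second factor. Thus $w=ud$ matches the two counts.
  have key : ∀ d ∈ X₂ L K I, ∀ u ∈ parabolic K,
      u⁻¹ * g * u ∈ parabolic (K ∩ conj d I) ↔ (u * d)⁻¹ * g * (u * d) ∈ parabolic I := by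
    intro d hd u hu
    rw [mem_parabolic_inter_conj cs hL hK hI hd]
    simp [mul_assoc, mul_mem, hu]
  refine Nat.card_eq_of_bijective (fun p => ⟨p.2.1 * p.1.1,
    (mul_mem_X_iff_of_mem_X₂ cs hL hK hI (hd p.1) p.2.2.1.1).mpr p.2.2.1,
    (key _ (hd p.1) _ p.2.2.1.1).mp p.2.2.2⟩) ⟨?_, ?_⟩
  · rintro ⟨⟨d, hd1⟩, ⟨u, hu⟩⟩ ⟨⟨d', hd1'⟩, ⟨u', hu'⟩⟩ h
    obtain ⟨rfl, rfl⟩ := eq_of_mul_eq_mul_of_mem_X₂ cs hL hK (hd ⟨d, hd1⟩) (hd ⟨d', hd1'⟩)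
      hu.1.1 hu'.1.1 (congrArg Subtype.val h)
    rfl
  · rintro ⟨w, hw, hw'⟩
    obtain ⟨d, hd', u, hu, rfl⟩ := exists_mul_of_mem_X cs hL hK hI hw
    exact ⟨⟨⟨d, by simpa using hd'⟩, ⟨u, hu, (key d hd' u hu.1).mpr hw'⟩⟩, rfl⟩

end DescentAlgebra

/-! ### Conjugation as an algebra isomorphism -/

namespace DescentAlgebra

variable {B W : Type*} [Group W] [Finite W] {M : CoxeterMatrix B} (cs : CoxeterSystem M W)
  {L K K' : Set W}

/-- Conjugation by `d`, as an isomorphism `Σ(W_{K'}) ≃ Σ(W_K)`. -/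
noncomputable def conjAlgEquiv (hL : L ⊆ Set.range cs.simple) (hK : K ⊆ L) (hK' : K' ⊆ L) {d : W}
    (hd : d ∈ X₂ L K K') (hc : conj d K' = K) (h1' : 1 ∈ descent K')
    (hm' : ∀ y z, y ∈ descent K' → z ∈ descent K' → y * z ∈ descent K') (h1 : 1 ∈ descent K)
    (hm : ∀ y z, y ∈ descent K → z ∈ descent K → y * z ∈ descent K) :
    (descent K').toSubalgebra h1' hm' ≃ₐ[ℚ] (descent K).toSubalgebra h1 hm :=
  have hinv : MonoidAlgebra.of ℚ W d⁻¹ * MonoidAlgebra.of ℚ W d = 1 := by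
    rw [← map_mul, inv_mul_cancel, map_one]
  have hinv' : MonoidAlgebra.of ℚ W d * MonoidAlgebra.of ℚ W d⁻¹ = 1 := by
    rw [← map_mul, mul_inv_cancel, map_one]
  AlgEquiv.ofLinearEquiv
    { toFun := fun z => ⟨MonoidAlgebra.of ℚ W d * z * MonoidAlgebra.of ℚ W d⁻¹,
        of_mul_mem_descent cs hL hK hK' hd.2 hc z.2⟩
      invFun := fun z => ⟨MonoidAlgebra.of ℚ W d⁻¹ * z * MonoidAlgebra.of ℚ W d, by
        have h := of_mul_mem_descent cs hL hK' hK hd.1 (conj_inv_of_conj_eq hc) z.2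
        rwa [inv_inv] at h⟩
      map_add' := fun y z => Subtype.ext (by simp only [Subalgebra.coe_add, mul_add, add_mul])
      map_smul' := fun c z => Subtype.ext (by
        simp only [Subalgebra.coe_smul, mul_smul_comm, smul_mul_assoc, RingHom.id_apply])
      left_inv := fun z => Subtype.ext (by
        simp only [mul_assoc, hinv, mul_one]
        rw [← mul_assoc, hinv, one_mul])
      right_inv := fun z => Subtype.ext (by
        simp only [mul_assoc, hinv', mul_one]
        rw [← mul_assoc, hinv', one_mul]) }
    (Subtype.ext (by
      change MonoidAlgebra.of ℚ W d * 1 * MonoidAlgebra.of ℚ W d⁻¹ = 1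
      rw [mul_one, hinv']))
    (fun y z => Subtype.ext (by
      change MonoidAlgebra.of ℚ W d * (y * z) * MonoidAlgebra.of ℚ W d⁻¹ =
        MonoidAlgebra.of ℚ W d * y * MonoidAlgebra.of ℚ W d⁻¹ *
          (MonoidAlgebra.of ℚ W d * z * MonoidAlgebra.of ℚ W d⁻¹)
      simp only [mul_assoc]
      rw [← mul_assoc (MonoidAlgebra.of ℚ W d⁻¹) (MonoidAlgebra.of ℚ W d), hinv, one_mul]))

end DescentAlgebra

open DescentAlgebra in
theorem mainTheorem10 {B W : Type*} [Group W] [Finite W] {M : CoxeterMatrix B}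
    (cs : CoxeterSystem M W) (S : Set W) (hS : S = Set.range cs.simple) :
    -- the elements `x_I^L` form a basis of `Σ(W_L)`, and the linear maps `Res_K^L` and `θ_L`
    -- take the prescribed values on it
    (∀ L ⊆ S, LinearIndependent ℚ fun I : {I : Set W // I ⊆ L} => x L I) ∧
    (∀ L ⊆ S, ∀ K ⊆ L, ∀ (I : Set W) (hI : I ⊆ L),
      (res L K ⟨x L I, x_mem hI⟩ : ℚ[W]) =
        ∑ d ∈ (X₂ L K I).toFinite.toFinset, x K (K ∩ conj d I)) ∧
    (∀ L ⊆ S, ∀ (I : Set W) (hI : I ⊆ L),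
      θ L ⟨x L I, x_mem hI⟩ = inducedTrivial L ⟨I, hI⟩) ∧
    -- `Σ(W_L)` is a unital subalgebra of the group algebra
    ∃ (h1 : ∀ L ⊆ S, 1 ∈ descent L)
      (hm : ∀ L ⊆ S, ∀ x y, x ∈ descent L → y ∈ descent L → x * y ∈ descent L),
    ∀ (K : Set W) (hK : K ⊆ S),
      -- `x_K Res_K(x) = x x_K`
      (∀ y : descent S, x S K * (res S K y : ℚ[W]) = (y : ℚ[W]) * x S K) ∧
      -- `Res_K` is a homomorphism of algebras
      (∃ φ : (descent S).toSubalgebra (h1 S subset_rfl) (hm S subset_rfl) →ₐ[ℚ]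
            (descent K).toSubalgebra (h1 K hK) (hm K hK),
          ∀ y : descent S, φ ⟨y, y.2⟩ = ⟨res S K y, (res S K y).2⟩) ∧
      -- transitivity
      (∀ L ⊆ S, K ⊆ L → res S K = (res L K).comp (res S L)) ∧
      -- compatibility with `θ` and restriction of characters; here `W_S = W`
      (CharacterSpace.restrict (Subgroup.inclusion (Subgroup.closure_mono hK))).comp (θ S) =
        (θ K).comp (res S K) ∧
      -- compatibility with conjugation
      (∀ (K' : Set W) (hK' : K' ⊆ S), ∀ d ∈ X₂ S K K', conj d K' = K →
        ∃ c : (descent K').toSubalgebra (h1 K' hK') (hm K' hK') ≃ₐ[ℚ]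
            (descent K).toSubalgebra (h1 K hK) (hm K hK),
          (∀ z, (c z : ℚ[W]) = MonoidAlgebra.of ℚ W d * z * MonoidAlgebra.of ℚ W d⁻¹) ∧
          ∀ y : descent S, (res S K y : ℚ[W]) = c ⟨res S K' y, (res S K' y).2⟩) ∧
      -- `Σ(W) = Ker Res_K ⊕ Σ(W) x_K`
      ((descent S).map (LinearMap.mulRight ℚ (x S K)) ≤ descent S ∧
        IsCompl (LinearMap.ker (res S K))
          (((descent S).map (LinearMap.mulRight ℚ (x S K))).comap (descent S).subtype)) ∧
      -- `Ker Res_K = {x | x x_K = 0}`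
      (∀ y : descent S, y ∈ LinearMap.ker (res S K) ↔ (y : ℚ[W]) * x S K = 0) := by
  have hS' : S ⊆ Set.range cs.simple := hS.le
  refine ⟨fun L hL => linearIndependent_x cs (hL.trans hS'),
    fun L hL K _ I hI => res_x cs (hL.trans hS') K hI,
    fun L hL I hI => θ_x cs (hL.trans hS') hI,
    fun L hL => one_mem_descent cs (hL.trans hS'),
    fun L hL y z hy hz => mul_mem_descent cs (hL.trans hS') hy hz, fun K hK => ⟨?_, ?_, ?_, ?_,
      ?_, ⟨?_, ?_⟩, ?_⟩⟩
  · exact x_mul_res cs hS' hK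
  · refine ⟨AlgHom.ofLinearMap (res S K) ?_ ?_, fun y => rfl⟩
    · exact Subtype.ext (res_one cs hS' hK)
    · exact fun y z => Subtype.ext (res_mul cs hS' hK y z)
  · exact fun L hL hKL => res_comp_res cs hS' hL hKL
  · exact restrict_comp_θ cs hS' hK
  · intro K' hK' d hd hc
    exact ⟨conjAlgEquiv cs hS' hK hK' hd hc _ _ _ _, fun z => rfl,
      res_eq_conj cs hS' hK hK' hd.2 hc⟩
  · exact map_mulRight_le cs hS' hK
  · exact isCompl_ker_res cs hS' hK
  · exact fun y => LinearMap.mem_ker.trans (res_eq_zero_iff cs hS' hK y)
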